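/- **Theorem 4.4.** All vector spaces are complex and finite-dimensional. Let $U$ be an $n$-dimensional vector space, $n\ge 1$, with a nondegenerate symmetric bilinear form $(-,-)$, let $\mathrm{C}\ell(U)$ be its Clifford algebra (with $x^2=(x,x)1$ for $x\in U$), and let $S^{(n)}$ be an irreducible $\mathrm{C}\ell(U)$-module with a nondegenerate bilinear form $\langle-,-\rangle$ such that, for some signs $\sigma,\tau\in\{1,-1\}$, $\langle\psi,\chi\rangle=\sigma\langle\chi,\psi\rangle$ and $\langle x\cdot\psi,\chi\rangle=\tau\langle\psi,x\cdot\chi\rangle$ for all $\psi,\chi\in S^{(n)}$, $x\in U$. Define $\xi:S^{(n)}\times S^{(n)}\to U$ by $(x,\xi(\psi,\chi))=\langle\psi,x\cdot\chi\rangle$. If $n=2p$, fix an orthonormal basis $e_1,\dots,e_{2p}$ of $U$ and let $S_\pm^{(n)}\subset S^{(n)}$ be the subspaces on which $\varpi=i^p e_1\cdots e_{2p}$ acts as $\pm1$. Let $\mathfrak g$ be a Lie algebra and $V$ a representation of $\mathfrak g$; if $n$ is even, let $V=V_+\oplus V_-$ be a direct sum of two subrepresentations. Let $b:V\times V\to\mathbb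 C$ be a nondegenerate $\mathfrak g$-invariant bilinear form and $c:V\times V\to\mathfrak g$ a $\mathfrak g$-equivariant bilinear map with $b(v,w)=\sigma\tau\, b(w,v)$ and $c(v,w)=\sigma\, c(w,v)$. If $n=2p$, assume moreover that $b(V_\pm,V_\mp)=0$ and $c(V_\pm,V_\pm)=0$ if $p$ is odd, and that $b(V_\pm,V_\pm)=0$ and $c(V_\pm,V_\mp)=0$ if $p$ is even. The Poincaré superalgebra $\mathfrak P(n)$ has even part $\mathfrak{so}(U)\oplus U\oplus\mathfrak g$ (the direct sum of the Poincaré algebra $\mathfrak{so}(U)\oplus U$ and $\mathfrak g$) and odd part $S^{(n)}\otimes V$ if $n$ is odd, $S_+^{(n)}\otimes V_+\oplus S_-^{(n)}\otimes V_-$ if $n$ is even. An even element acts on the odd part by $$[A,\psi\otimes v]=s_A\cdot\psi\otimes v,\qquad [x,\psi\otimes v]=0,\qquad [X,\psi\otimes v]=\psi\otimes X\cdot v$$ for $A\in\mathfrak{so}(U)$, $x\in U$, $X\in\mathfrak g$, where $s_A\in\mathrm{C}\ell(U)$ is linear in $A$ and equals $\tfrac14(x_1x_2-x_2x_1)$ if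 $A=(x_2,-)\,x_1-(x_1,-)\,x_2$. The bracket of odd elements is given by $$[\psi\otimes v,\chi\otimes w]=\xi(\psi,\chi)\,b(v,w)+\langle\psi,\chi\rangle\,c(v,w).$$ The $[\bar1\bar1\bar1]$ Jacobi identity is the condition that $[[\alpha,\beta],\gamma]+[[\beta,\gamma],\alpha]+[[\gamma,\alpha],\beta]=0$ for all odd $\alpha,\beta,\gamma$. Then: - if $n\ge4$, the $[\bar1\bar1\bar1]$ Jacobi identity holds if and only if $c(v,w)\cdot u=0$ for all $v,w,u\in V$ (the conventional solution); - if $n=3$, it holds if and only if $c(v,w)\cdot u+c(u,w)\cdot v=0$ for all $v,w,u\in V$; - if $n=2$, it holds if and only if $c(v_\pm,w_\mp)\cdot u_\pm+c(u_\pm,w_\mp)\cdot v_\pm=0$ for all $v_\pm,u_\pm\in V_\pm$ and $w_\mp\in V_\mp$ (for both choices of the sign); - if $n=1$, it holds if and only if $c(v,w)\cdot u+c(w,u)\cdot v+c(u,v)\cdot w=0$ for all $v,w,u\in V$. -/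

import Mathlib

open scoped TensorProduct

namespace PoincareSuper

/-- The data defining a Poincaré superalgebra in `n` dimensions.

* `U` is an `n`-dimensional complex vector space, `B` its nondegenerate symmetric bilinear form,
  with an orthonormal basis `e` that fixes the sign of the element `ϖ` (see `volume`).
* `S` is an irreducible module over the Clifford algebra of `U` (with the relation `x² = (x, x) 1`),
  with a nondegenerate bilinear form `form` that is symmetric up to the sign `σ` and for which
  Clifford multiplication by vectors is self-adjoint up to the sign `τ`.
* `V` is a representation of the Lie algebra `𝔤`; if `n` is even, then `V = V₊ ⊕ V₋`
  for the subrepresentations `V₊ = Vc 1` and `V₋ = Vc (-1)` (`Vc` plays no role if `n` is odd).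
* `b` is a nondegenerate `𝔤`-invariant bilinear form on `V` and `c : V × V → 𝔤` is a
  `𝔤`-equivariant bilinear map. They have the symmetries that make the odd-odd bracket symmetric
  and, for even `n`, the components of `b` and `c` that do not enter this bracket are zero. -/
structure PoincareData (n : ℕ) (U S 𝔤 V : Type*)
    [AddCommGroup U] [Module ℂ U] [FiniteDimensional ℂ U]
    (B : LinearMap.BilinForm ℂ U)
    [AddCommGroup S] [Module ℂ S] [FiniteDimensional ℂ S]
    [Module (CliffordAlgebra (LinearMap.BilinMap.toQuadraticMap B)) S]
    [IsScalarTower ℂ (CliffordAlgebra (LinearMap.BilinMap.toQuadraticMap B)) S]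
    [IsSimpleModule (CliffordAlgebra (LinearMap.BilinMap.toQuadraticMap B)) S]
    [LieRing 𝔤] [LieAlgebra ℂ 𝔤] [FiniteDimensional ℂ 𝔤]
    [AddCommGroup V] [Module ℂ V] [FiniteDimensional ℂ V]
    [LieRingModule 𝔤 V] [LieModule ℂ 𝔤 V] where
  B_symm : ∀ x y, B x y = B y x
  B_nondeg : B.Nondegenerate
  e : Module.Basis (Fin n) ℂ U
  e_orthonormal : ∀ i j, B (e i) (e j) = if i = j then 1 else 0
  form : LinearMap.BilinForm ℂ S
  form_nondeg : form.Nondegenerate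
  σ : ℂ
  σ_sign : σ = 1 ∨ σ = -1
  τ : ℂ
  τ_sign : τ = 1 ∨ τ = -1
  form_symm : ∀ ψ χ, form ψ χ = σ * form χ ψ
  form_clifford : ∀ (x : U) (ψ χ : S),
    form (CliffordAlgebra.ι (LinearMap.BilinMap.toQuadraticMap B) x • ψ) χ =
      τ * form ψ (CliffordAlgebra.ι (LinearMap.BilinMap.toQuadraticMap B) x • χ)
  Vc : ℤˣ → LieSubmodule ℂ 𝔤 V
  Vc_compl : Even n → IsCompl (Vc 1) (Vc (-1))
  b : LinearMap.BilinForm ℂ V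
  b_nondeg : b.Nondegenerate
  b_invariant : ∀ (X : 𝔤) (v w : V), b ⁅X, v⁆ w + b v ⁅X, w⁆ = 0
  b_symm : ∀ v w, b v w = σ * τ * b w v
  c : V →ₗ[ℂ] V →ₗ[ℂ] 𝔤
  c_equivariant : ∀ (X : 𝔤) (v w : V), ⁅X, c v w⁆ = c ⁅X, v⁆ w + c v ⁅X, w⁆
  c_symm : ∀ v w, c v w = σ • c w v
  b_chiral_of_odd : Even n → Odd (n / 2) → ∀ s, ∀ v ∈ Vc s, ∀ w ∈ Vc (-s), b v w = 0
  c_chiral_of_odd : Even n → Odd (n / 2) → ∀ s, ∀ v ∈ Vc s, ∀ w ∈ Vc s, c v w = 0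
  b_chiral_of_even : Even n → Even (n / 2) → ∀ s, ∀ v ∈ Vc s, ∀ w ∈ Vc s, b v w = 0
  c_chiral_of_even : Even n → Even (n / 2) → ∀ s, ∀ v ∈ Vc s, ∀ w ∈ Vc (-s), c v w = 0

namespace PoincareData

/- Endomorphisms form a Lie algebra under the commutator. -/
attribute [local instance 100] LieRing.ofAssociativeRing

variable {n : ℕ} {U S 𝔤 V : Type*}
    [AddCommGroup U] [Module ℂ U] [FiniteDimensional ℂ U]
    {B : LinearMap.BilinForm ℂ U}
    [AddCommGroup S] [Module ℂ S] [FiniteDimensional ℂ S]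
    [Module (CliffordAlgebra (LinearMap.BilinMap.toQuadraticMap B)) S]
    [IsScalarTower ℂ (CliffordAlgebra (LinearMap.BilinMap.toQuadraticMap B)) S]
    [IsSimpleModule (CliffordAlgebra (LinearMap.BilinMap.toQuadraticMap B)) S]
    [LieRing 𝔤] [LieAlgebra ℂ 𝔤] [FiniteDimensional ℂ 𝔤]
    [AddCommGroup V] [Module ℂ V] [FiniteDimensional ℂ V]
    [LieRingModule 𝔤 V] [LieModule ℂ 𝔤 V]

/-- The Clifford algebra of `U`. -/
abbrev Cl (_ : PoincareData n U S 𝔤 V B) : Type _ :=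
  CliffordAlgebra (LinearMap.BilinMap.toQuadraticMap B)

/-- The inclusion of `U` in its Clifford algebra. -/
noncomputable abbrev vec (D : PoincareData n U S 𝔤 V B) : U →ₗ[ℂ] D.Cl :=
  CliffordAlgebra.ι (LinearMap.BilinMap.toQuadraticMap B)

/-- The action of the Clifford algebra on `S`. -/
noncomputable def cliffordAction (D : PoincareData n U S 𝔤 V B) :
    D.Cl →ₐ[ℂ] Module.End ℂ S :=
  Algebra.lsmul ℂ ℂ S

/-- The element `ϖ = iᵖ e₁ ⋯ eₙ` of the Clifford algebra, where `p = ⌊n / 2⌋`. -/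
noncomputable def volume (D : PoincareData n U S 𝔤 V B) : D.Cl :=
  Complex.I ^ (n / 2) • ((List.finRange n).map fun i => D.vec (D.e i)).prod

/-- For even `n`, the space `S₊` (`s = 1`) or `S₋` (`s = -1`) of spinors on which `ϖ` is `s`. -/
noncomputable def Sc (D : PoincareData n U S 𝔤 V B) (s : ℤˣ) : Submodule ℂ S :=
  (D.cliffordAction D.volume).eigenspace (((s : ℤ) : ℂ))

/-- The Lie algebra `𝔰𝔬(U)`. -/
abbrev so (_ : PoincareData n U S 𝔤 V B) : LieSubalgebra ℂ (Module.End ℂ U) :=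
  skewAdjointLieSubalgebra B

/-- The element `s_A` of the Clifford algebra, `s_A = ¼ ∑ᵢ (A eᵢ) eᵢ`; for
`A = x₁ ⊗ x₂♭ - x₂ ⊗ x₁♭` it is `¼ (x₁ x₂ - x₂ x₁)` (see `spin_wedge`). -/
noncomputable def spin (D : PoincareData n U S 𝔤 V B) : D.so →ₗ[ℂ] D.Cl where
  toFun A := (1 / 4 : ℂ) • ∑ i, D.vec ((A : Module.End ℂ U) (D.e i)) * D.vec (D.e i)
  map_add' A A' := by
    simp only [AddMemClass.coe_add, LinearMap.add_apply, map_add, add_mul,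
      Finset.sum_add_distrib, smul_add]
  map_smul' r A := by
    simp only [SetLike.val_smul, LinearMap.smul_apply, map_smul, smul_mul_assoc,
      ← Finset.smul_sum, RingHom.id_apply]
    rw [smul_comm]

/-- The bilinear map `ξ : S × S → U` with `(x, ξ(ψ, χ)) = ⟨ψ, x · χ⟩` (see `xi_spec`). -/
noncomputable def xi (D : PoincareData n U S 𝔤 V B) : S →ₗ[ℂ] S →ₗ[ℂ] U :=
  LinearMap.mk₂ ℂ
    (fun ψ χ => (B.toDual D.B_nondeg).symm
      (D.form ψ ∘ₗ (D.cliffordAction.toLinearMap ∘ₗ D.vec).flip χ))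
    (fun ψ ψ' χ => by simp only [map_add, LinearMap.add_comp])
    (fun r ψ χ => by simp only [map_smul, LinearMap.smul_comp])
    (fun ψ χ χ' => by simp only [map_add, LinearMap.comp_add])
    (fun r ψ χ => by simp only [map_smul, LinearMap.comp_smul])

theorem xi_spec (D : PoincareData n U S 𝔤 V B) (x : U) (ψ χ : S) :
    B x (D.xi ψ χ) = D.form ψ (D.vec x • χ) := by
  rw [D.B_symm]
  simp only [xi, LinearMap.mk₂_apply, LinearMap.BilinForm.apply_toDual_symm_apply]
  rfl

/-- The even part `𝔰𝔬(U) ⊕ U ⊕ 𝔤` of the Poincaré superalgebra. -/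
abbrev EvenPart (D : PoincareData n U S 𝔤 V B) : Type _ := D.so × U × 𝔤

/-- The odd part of the Poincaré superalgebra, as a subspace of `S ⊗ V`: it is `S ⊗ V` if `n` is
odd, and `S₊ ⊗ V₊ ⊕ S₋ ⊗ V₋` if `n` is even. -/
noncomputable def oddPart (D : PoincareData n U S 𝔤 V B) : Submodule ℂ (S ⊗[ℂ] V) :=
  if Even n then
    Submodule.map₂ (TensorProduct.mk ℂ S V) (D.Sc 1) (D.Vc 1).toSubmodule ⊔
      Submodule.map₂ (TensorProduct.mk ℂ S V) (D.Sc (-1)) (D.Vc (-1)).toSubmodule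
  else ⊤

/-- The bracket on the even part: `[A, A'] = A A' - A' A`, `[A, x] = A x`, `[x, x'] = 0`, the
bracket of `𝔤`, and `[𝔰𝔬(U) ⊕ U, 𝔤] = 0`. -/
noncomputable def evenBracket (D : PoincareData n U S 𝔤 V B) (a a' : D.EvenPart) : D.EvenPart :=
  (⁅a.1, a'.1⁆,
    (a.1 : Module.End ℂ U) a'.2.1 - (a'.1 : Module.End ℂ U) a.2.1,
    ⁅a.2.2, a'.2.2⁆)

/-- The action of the even part on `S ⊗ V`: `[A, ψ ⊗ v] = s_A · ψ ⊗ v`, `[x, ψ ⊗ v] = 0` and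
`[X, ψ ⊗ v] = ψ ⊗ X · v`. -/
noncomputable def evenAction (D : PoincareData n U S 𝔤 V B) (a : D.EvenPart) :
    Module.End ℂ (S ⊗[ℂ] V) :=
  (D.cliffordAction (D.spin a.1)).rTensor V + (LieModule.toEnd ℂ 𝔤 V a.2.2).lTensor S

theorem evenAction_tmul (D : PoincareData n U S 𝔤 V B) (a : D.EvenPart) (ψ : S) (v : V) :
    D.evenAction a (ψ ⊗ₜ v) = (D.spin a.1 • ψ) ⊗ₜ v + ψ ⊗ₜ ⁅a.2.2, v⁆ := rfl

/-- The odd-odd bracket `[ψ ⊗ v, χ ⊗ w] = ξ(ψ, χ) b(v, w) + ⟨ψ, χ⟩ c(v, w)`, on all of `S ⊗ V`. -/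
noncomputable def oddBracket (D : PoincareData n U S 𝔤 V B) :
    S ⊗[ℂ] V →ₗ[ℂ] S ⊗[ℂ] V →ₗ[ℂ] D.EvenPart :=
  ((TensorProduct.map₂ D.xi D.b).compr₂ (TensorProduct.rid ℂ U).toLinearMap).compr₂
      (LinearMap.inr ℂ D.so (U × 𝔤) ∘ₗ LinearMap.inl ℂ U 𝔤) +
    ((TensorProduct.map₂ D.form D.c).compr₂ (TensorProduct.lid ℂ 𝔤).toLinearMap).compr₂
      (LinearMap.inr ℂ D.so (U × 𝔤) ∘ₗ LinearMap.inr ℂ U 𝔤)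

theorem oddBracket_tmul (D : PoincareData n U S 𝔤 V B) (ψ χ : S) (v w : V) :
    D.oddBracket (ψ ⊗ₜ v) (χ ⊗ₜ w) = (0, D.b v w • D.xi ψ χ, D.form ψ χ • D.c v w) := by
  simp [oddBracket]

theorem vec_mul_vec_of_ne (D : PoincareData n U S 𝔤 V B) {i j : Fin n} (h : i ≠ j) :
    D.vec (D.e i) * D.vec (D.e j) = -(D.vec (D.e j) * D.vec (D.e i)) := by
  rw [eq_neg_iff_add_eq_zero, CliffordAlgebra.ι_mul_ι_add_swap,
    LinearMap.BilinMap.polar_toQuadraticMap, D.e_orthonormal, D.e_orthonormal, if_neg h,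
    if_neg h.symm, add_zero, map_zero]

theorem vec_mul_prod (D : PoincareData n U S 𝔤 V B) (j : Fin n) (l : List (Fin n)) :
    D.vec (D.e j) * (l.map fun i => D.vec (D.e i)).prod =
      (-1 : ℂ) ^ (l.countP (fun i => i ≠ j)) •
        ((l.map fun i => D.vec (D.e i)).prod * D.vec (D.e j)) := by
  induction l with
  | nil => simp
  | cons i l ih =>
    by_cases h : i = j
    · subst h
      rw [List.countP_cons_of_neg (by simp), List.map_cons, List.prod_cons, mul_assoc, ih,
        mul_smul_comm]
    · rw [List.countP_cons_of_pos (by simpa using h), List.map_cons, List.prod_cons, ← mul_assoc,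
        D.vec_mul_vec_of_ne (Ne.symm h), neg_mul, mul_assoc, ih, mul_smul_comm, pow_succ,
        mul_neg_one, neg_smul, mul_assoc]

theorem vec_mul_volume (D : PoincareData n U S 𝔤 V B) (hn : Even n) (x : U) :
    D.vec x * D.volume = -(D.volume * D.vec x) := by
  have key : ∀ j, D.vec (D.e j) * D.volume = -(D.volume * D.vec (D.e j)) := by
    intro j
    have hc : (List.finRange n).countP (fun i => i ≠ j) + 1 = n := by
      have h1 := List.length_eq_countP_add_countP (fun i : Fin n => decide (i ≠ j))
        (l := List.finRange n)
      have h2 : (List.finRange n).countP (fun i => decide (¬ (decide (i ≠ j) = true))) = 1 := by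
        have h3 := List.count_eq_one_of_mem (List.nodup_finRange n) (List.mem_finRange j)
        rw [List.count] at h3
        rw [← h3]
        congr 1
        funext i
        by_cases h : i = j <;> simp [h]
      rw [List.length_finRange] at h1
      omega
    have hodd : Odd ((List.finRange n).countP (fun i => i ≠ j)) := by
      rw [← Nat.not_even_iff_odd]
      intro he
      rw [← hc] at hn
      exact (Nat.even_add_one.mp hn) he
    rw [volume, mul_smul_comm, D.vec_mul_prod, hodd.neg_one_pow, neg_one_smul, smul_neg,
      smul_mul_assoc]
  have hx := D.e.sum_repr x
  rw [← hx]
  simp only [map_sum, map_smul, Finset.sum_mul, Finset.mul_sum, smul_mul_assoc, mul_smul_comm,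
    key, smul_neg, Finset.sum_neg_distrib]

theorem spin_mul_volume (D : PoincareData n U S 𝔤 V B) (hn : Even n) (A : D.so) :
    D.spin A * D.volume = D.volume * D.spin A := by
  have key : ∀ x y : U, D.vec x * D.vec y * D.volume = D.volume * (D.vec x * D.vec y) := by
    intro x y
    rw [mul_assoc, D.vec_mul_volume hn, mul_neg, ← mul_assoc, D.vec_mul_volume hn, neg_mul,
      neg_neg, mul_assoc]
  simp only [spin, LinearMap.coe_mk, AddHom.coe_mk, smul_mul_assoc, mul_smul_comm,
    Finset.sum_mul, Finset.mul_sum, key]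

theorem evenAction_mem (D : PoincareData n U S 𝔤 V B) (a : D.EvenPart) {z : S ⊗[ℂ] V}
    (hz : z ∈ D.oddPart) : D.evenAction a z ∈ D.oddPart := by
  unfold oddPart at hz ⊢
  split_ifs at hz ⊢ with hn
  · have key : ∀ s : ℤˣ, Submodule.map₂ (TensorProduct.mk ℂ S V) (D.Sc s) (D.Vc s).toSubmodule ≤
        (Submodule.map₂ (TensorProduct.mk ℂ S V) (D.Sc s) (D.Vc s).toSubmodule).comap
          (D.evenAction a) := by
      intro s
      rw [Submodule.map₂_le]
      intro ψ hψ v hv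
      rw [Submodule.mem_comap, TensorProduct.mk_apply, D.evenAction_tmul]
      refine add_mem (Submodule.apply_mem_map₂ _ ?_ hv)
        (Submodule.apply_mem_map₂ _ hψ (LieSubmodule.lie_mem _ hv))
      have h : D.volume • ψ = ((s : ℤ) : ℂ) • ψ := Module.End.mem_eigenspace_iff.mp hψ
      refine Module.End.mem_eigenspace_iff.mpr ?_
      change D.volume • D.spin a.1 • ψ = ((s : ℤ) : ℂ) • D.spin a.1 • ψ
      rw [smul_smul, ← D.spin_mul_volume hn, ← smul_smul, h, smul_comm]
    exact (sup_le ((key 1).trans (Submodule.comap_mono le_sup_left))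
      ((key (-1)).trans (Submodule.comap_mono le_sup_right))) hz
  · exact Submodule.mem_top

/-- `s_A = ¼ (x y - y x)` for `A = x ⊗ y♭ - y ⊗ x♭`. -/
theorem spin_wedge (D : PoincareData n U S 𝔤 V B) (A : D.so) (x y : U)
    (hA : ∀ z, (A : Module.End ℂ U) z = B y z • x - B x z • y) :
    D.spin A = (1 / 4 : ℂ) • (D.vec x * D.vec y - D.vec y * D.vec x) := by
  have exp : ∀ z : U, ∑ i, B z (D.e i) • D.e i = z := by
    intro z
    conv_rhs => rw [← D.e.sum_repr z]
    refine Finset.sum_congr rfl fun i _ => ?_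
    congr 1
    conv_lhs => rw [← D.e.sum_repr z]
    simp only [map_sum, map_smul, LinearMap.sum_apply, LinearMap.smul_apply, D.e_orthonormal]
    simp
  have h : ∀ z w : U, ∑ i, D.vec (B z (D.e i) • w) * D.vec (D.e i) = D.vec w * D.vec z := by
    intro z w
    conv_rhs => rw [← exp z]
    simp only [map_sum, map_smul, Finset.mul_sum, smul_mul_assoc, mul_smul_comm]
  simp only [spin, LinearMap.coe_mk, AddHom.coe_mk, hA, map_sub, sub_mul,
    Finset.sum_sub_distrib, h]

/-- The Poincaré superalgebra `𝔓(n)`, as the direct sum of its even and odd parts. -/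
abbrev Superalgebra (D : PoincareData n U S 𝔤 V B) : Type _ := D.EvenPart × D.oddPart

/-- The bracket of the Poincaré superalgebra. -/
noncomputable def bracket (D : PoincareData n U S 𝔤 V B) (x y : D.Superalgebra) :
    D.Superalgebra :=
  (D.evenBracket x.1 y.1 + D.oddBracket x.2 y.2,
    (⟨D.evenAction x.1 y.2, D.evenAction_mem x.1 y.2.2⟩ : D.oddPart) -
      ⟨D.evenAction y.1 x.2, D.evenAction_mem y.1 x.2.2⟩)

/-- The odd-odd-odd component of the Jacobi identity of the Poincaré superalgebra. -/
def Jacobi111 (D : PoincareData n U S 𝔤 V B) : Prop :=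
  ∀ x y z : D.Superalgebra, x.1 = 0 → y.1 = 0 → z.1 = 0 →
    D.bracket (D.bracket x y) z + D.bracket (D.bracket y z) x + D.bracket (D.bracket z x) y = 0

end PoincareData

end PoincareSuper

open scoped TensorProduct

namespace PoincareSuper

namespace PoincareData

variable {n : ℕ} {U S 𝔤 V : Type*}
    [AddCommGroup U] [Module ℂ U] [FiniteDimensional ℂ U]
    {B : LinearMap.BilinForm ℂ U}
    [AddCommGroup S] [Module ℂ S] [FiniteDimensional ℂ S]
    [Module (CliffordAlgebra (LinearMap.BilinMap.toQuadraticMap B)) S]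
    [IsScalarTower ℂ (CliffordAlgebra (LinearMap.BilinMap.toQuadraticMap B)) S]
    [IsSimpleModule (CliffordAlgebra (LinearMap.BilinMap.toQuadraticMap B)) S]
    [LieRing 𝔤] [LieAlgebra ℂ 𝔤] [FiniteDimensional ℂ 𝔤]
    [AddCommGroup V] [Module ℂ V] [FiniteDimensional ℂ V]
    [LieRingModule 𝔤 V] [LieModule ℂ 𝔤 V]

/-! The bracket of two odd elements lies in `U ⊕ 𝔤`, and `U` acts by zero on the odd part, so `ξ`
and `b` drop out of the identity. What remains (`jacobi111_iff`) is that the cyclic sum of `⟨ψ, χ⟩ φ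
⊗ c(v, w)·u` vanishes on pure tensors, with chiralities matched for even `n`. The question is then
how much linear independence there is among the spinors.

If `⟨ψ, χ⟩ ≠ 0` and some admissible `φ` is independent of the spinors in the other two terms, a
linear functional on `S` (`Jacobi111.apply_functional`) isolates `c(v, w)·u`, which must vanish. For
odd `n ≥ 4` this works because `dim S ≥ 3` (`exists_notMem_span_pair`).

For `n = 2p`, `form_volume` shows that the form pairs opposite chiralities if `p` is odd and equal
ones if `p` is even. For odd `p` and `n > 2`, each `S_±` has dimension at least two
(`exists_notMem_span_singleton`), which suffices. For even `p`, chirality alone handles `u` opposite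
to `v` and `w`; the invariance of `b` carries the result over to `u` of the same chirality.

In low dimensions there are too few spinors. `S` is a line for `n = 1`, each `S_±` is a line for `n
= 2`, and `S` is a symplectic plane for `n = 3`; the spinors factor out and leave the stated weaker
conditions. -/

/-! ### The gamma matrices -/

/-- The action of the basis vector `e i` on spinors. -/
noncomputable def gamma (D : PoincareData n U S 𝔤 V B) (i : Fin n) : Module.End ℂ S :=
  D.cliffordAction (D.vec (D.e i))

theorem gamma_gamma (D : PoincareData n U S 𝔤 V B) (i : Fin n) (ψ : S) :
    D.gamma i (D.gamma i ψ) = ψ := by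
  rw [gamma, ← Module.End.mul_apply, ← map_mul, CliffordAlgebra.ι_sq_scalar,
    LinearMap.BilinMap.toQuadraticMap_apply, D.e_orthonormal, if_pos rfl, map_one, map_one,
    Module.End.one_apply]

theorem gamma_mul_self (D : PoincareData n U S 𝔤 V B) (i : Fin n) :
    D.gamma i * D.gamma i = 1 := LinearMap.ext (D.gamma_gamma i)

theorem gamma_anticomm (D : PoincareData n U S 𝔤 V B) {i j : Fin n} (h : i ≠ j) (ψ : S) :
    D.gamma i (D.gamma j ψ) = -D.gamma j (D.gamma i ψ) := by
  simp only [gamma, ← Module.End.mul_apply, ← map_mul]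
  rw [D.vec_mul_vec_of_ne h, map_neg, LinearMap.neg_apply]

theorem gamma_eq_zero_iff (D : PoincareData n U S 𝔤 V B) (i : Fin n) (ψ : S) :
    D.gamma i ψ = 0 ↔ ψ = 0 :=
  ⟨fun h => by rw [← D.gamma_gamma i ψ, h, map_zero], fun h => by rw [h, map_zero]⟩

theorem form_gamma (D : PoincareData n U S 𝔤 V B) (i : Fin n) (ψ χ : S) :
    D.form (D.gamma i ψ) χ = D.τ * D.form ψ (D.gamma i χ) :=
  D.form_clifford (D.e i) ψ χ

theorem nontrivial_spinors (_ : PoincareData n U S 𝔤 V B) : Nontrivial S :=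
  IsSimpleModule.nontrivial (CliffordAlgebra (LinearMap.BilinMap.toQuadraticMap B)) S

/-- A nonzero space of spinors that is stable under all gamma matrices is everything. -/
theorem eq_top_of_gamma_mem (D : PoincareData n U S 𝔤 V B) (W : Submodule ℂ S)
    (hW : ∀ i, ∀ ψ ∈ W, D.gamma i ψ ∈ W) {ψ : S} (hψ : ψ ∈ W) (h0 : ψ ≠ 0) : W = ⊤ := by
  have hv : ∀ x : U, ∀ ψ ∈ W, D.vec x • ψ ∈ W := by
    intro x ψ hψ
    rw [← D.e.sum_repr x, map_sum, Finset.sum_smul]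
    refine sum_mem fun i _ => ?_
    rw [map_smul, smul_assoc]
    exact W.smul_mem _ (hW i ψ hψ)
  have hc : ∀ a : CliffordAlgebra (LinearMap.BilinMap.toQuadraticMap B),
      ∀ ψ ∈ W, a • ψ ∈ W := by
    intro a
    induction a using CliffordAlgebra.induction with
    | algebraMap r =>
      intro ψ hψ
      rw [algebraMap_smul]
      exact W.smul_mem _ hψ
    | ι x => exact hv x
    | mul a b ha hb =>
      intro ψ hψ
      rw [mul_smul]
      exact ha _ (hb _ hψ)
    | add a b ha hb =>
      intro ψ hψ
      rw [add_smul]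
      exact add_mem (ha _ hψ) (hb _ hψ)
  let W' : Submodule (CliffordAlgebra (LinearMap.BilinMap.toQuadraticMap B)) S :=
    { W with smul_mem' := fun a ψ hψ => hc a ψ hψ }
  rcases eq_bot_or_eq_top W' with h | h
  · exact absurd ((Submodule.mem_bot _).mp (h ▸ (show ψ ∈ W' from hψ))) h0
  · exact eq_top_iff.mpr fun x _ => show x ∈ W' from h ▸ Submodule.mem_top

/-- An operator has an eigenvector in every nonzero stable subspace. -/
theorem exists_eigenvector_mem (T : Module.End ℂ S) (W : Submodule ℂ S)
    (hT : ∀ ψ ∈ W, T ψ ∈ W) {ψ : S} (hψ : ψ ∈ W) (h0 : ψ ≠ 0) :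
    ∃ φ ∈ W, φ ≠ 0 ∧ ∃ μ : ℂ, T φ = μ • φ := by
  have : Nontrivial W := ⟨⟨ψ, hψ⟩, 0, fun h => h0 (congrArg Subtype.val h)⟩
  obtain ⟨μ, hμ⟩ := Module.End.exists_eigenvalue (T.restrict hT)
  obtain ⟨φ, hφ⟩ := hμ.exists_hasEigenvector
  exact ⟨φ, φ.2, fun h => hφ.2 (Subtype.ext h), μ, congrArg Subtype.val hφ.apply_eq_smul⟩

/-- A nonzero spinor pairs nontrivially with some spinor. -/
theorem exists_form_ne_zero (D : PoincareData n U S 𝔤 V B) {ψ : S} (h0 : ψ ≠ 0) :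
    ∃ χ, D.form ψ χ ≠ 0 := by
  by_contra! h
  exact h0 (D.form_nondeg.1 ψ h)

/-! ### The volume element and chirality -/

theorem volume_action (D : PoincareData n U S 𝔤 V B) :
    D.cliffordAction D.volume =
      Complex.I ^ (n / 2) • ((List.finRange n).map D.gamma).prod := by
  rw [volume, map_smul, map_list_prod, List.map_map]
  rfl

theorem mem_Sc_iff (D : PoincareData n U S 𝔤 V B) (s : ℤˣ) (ψ : S) :
    ψ ∈ D.Sc s ↔ D.cliffordAction D.volume ψ = ((s : ℤ) : ℂ) • ψ :=
  Module.End.mem_eigenspace_iff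

theorem form_gamma_prod (D : PoincareData n U S 𝔤 V B) (l : List (Fin n)) (ψ χ : S) :
    D.form ((l.map D.gamma).prod ψ) χ =
      D.τ ^ l.length * D.form ψ ((l.reverse.map D.gamma).prod χ) := by
  induction l generalizing χ with
  | nil => simp
  | cons i l ih =>
    rw [List.map_cons, List.prod_cons, Module.End.mul_apply, D.form_gamma, ih,
      List.length_cons, List.reverse_cons, List.map_append, List.prod_append]
    simp only [List.map_cons, List.map_nil, List.prod_cons, List.prod_nil, mul_one,
      Module.End.mul_apply, pow_succ]
    ring

theorem prod_gamma_mul_reverse (D : PoincareData n U S 𝔤 V B) (l : List (Fin n)) :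
    (l.map D.gamma).prod * (l.reverse.map D.gamma).prod = 1 := by
  induction l with
  | nil => simp
  | cons i l ih =>
    rw [List.map_cons, List.prod_cons, List.reverse_cons, List.map_append, List.prod_append,
      mul_assoc, ← mul_assoc (l.map D.gamma).prod, ih]
    simp [gamma_mul_self]

theorem prod_gamma_mul_gamma (D : PoincareData n U S 𝔤 V B) (l : List (Fin n)) (i : Fin n)
    (h : i ∉ l) :
    (l.map D.gamma).prod * D.gamma i = (-1 : ℂ) ^ l.length • (D.gamma i * (l.map D.gamma).prod) := by
  induction l with
  | nil => simp
  | cons j l ih =>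
    rw [List.mem_cons, not_or] at h
    have hij : D.gamma j * D.gamma i = -(D.gamma i * D.gamma j) :=
      LinearMap.ext (D.gamma_anticomm (Ne.symm h.1))
    rw [List.map_cons, List.prod_cons, mul_assoc, ih h.2, mul_smul_comm, ← mul_assoc, hij,
      List.length_cons, pow_succ, mul_neg_one, neg_smul, neg_mul, smul_neg, mul_assoc]

theorem prod_gamma_reverse (D : PoincareData n U S 𝔤 V B) (l : List (Fin n)) (h : l.Nodup) :
    (l.reverse.map D.gamma).prod =
      (-1 : ℂ) ^ (l.length * (l.length - 1) / 2) • (l.map D.gamma).prod := by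
  induction l with
  | nil => simp
  | cons i l ih =>
    rw [List.nodup_cons] at h
    rw [List.reverse_cons, List.map_append, List.prod_append, ih h.2]
    simp only [List.map_cons, List.map_nil, List.prod_cons, List.prod_nil, mul_one]
    rw [smul_mul_assoc, D.prod_gamma_mul_gamma l i h.1, smul_smul, ← pow_add, List.length_cons]
    congr 2
    -- Both exponents are triangular numbers; writing them as sums removes the division and the
    -- truncated subtraction.
    rw [← Finset.sum_range_id_mul_two, ← Finset.sum_range_id_mul_two,
      Nat.mul_div_cancel _ two_pos, Nat.mul_div_cancel _ two_pos, Finset.sum_range_succ]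

theorem neg_one_pow_double (p : ℕ) :
    (-1 : ℂ) ^ ((p + p) * (p + p - 1) / 2) = (-1) ^ p := by
  have : (p + p) * (p + p - 1) / 2 = p * (p + p - 1) := by
    rw [← two_mul, mul_assoc, Nat.mul_div_cancel_left _ two_pos]
  rw [this]
  rcases p with _ | p
  · simp
  · have : Odd (p + 1 + (p + 1) - 1) := ⟨p, by omega⟩
    rw [mul_comm, pow_mul, this.neg_one_pow]

/-- Reversing the product of the `2p` gamma matrices costs `(-1)^p`, and `i^p` squares to `(-1)^p`:
the normalisation of `ϖ` makes the two signs cancel. -/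
theorem volume_volume (D : PoincareData n U S 𝔤 V B) (hn : Even n) (ψ : S) :
    D.cliffordAction D.volume (D.cliffordAction D.volume ψ) = ψ := by
  obtain ⟨p, rfl⟩ := hn
  have h1 := D.prod_gamma_mul_reverse (List.finRange (p + p))
  rw [D.prod_gamma_reverse _ (List.nodup_finRange _), List.length_finRange, neg_one_pow_double,
    mul_smul_comm] at h1
  have h2 : (p + p) / 2 = p := by omega
  rw [← Module.End.mul_apply, volume_action, h2, smul_mul_smul_comm, ← mul_pow, Complex.I_mul_I, h1,
    Module.End.one_apply]

/-- Moving `2p` gamma matrices across the form costs `τ^(2p) = 1` and reverses their order, which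
costs `(-1)^p`. This sign decides which chiralities the form pairs. -/
theorem form_volume (D : PoincareData n U S 𝔤 V B) (hn : Even n) (ψ χ : S) :
    D.form (D.cliffordAction D.volume ψ) χ =
      (-1) ^ (n / 2) * D.form ψ (D.cliffordAction D.volume χ) := by
  obtain ⟨p, rfl⟩ := hn
  have h2 : (p + p) / 2 = p := by omega
  have hτ : D.τ ^ (p + p) = 1 := by
    rcases D.τ_sign with h | h <;> simp [h, ← two_mul, pow_mul]
  rw [volume_action, h2, LinearMap.smul_apply, LinearMap.smul_apply, map_smul, map_smul,
    LinearMap.smul_apply, D.form_gamma_prod, D.prod_gamma_reverse _ (List.nodup_finRange _),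
    List.length_finRange, neg_one_pow_double, hτ, LinearMap.smul_apply, map_smul]
  simp only [smul_eq_mul]
  ring

theorem volume_gamma (D : PoincareData n U S 𝔤 V B) (hn : Even n) (i : Fin n) (ψ : S) :
    D.cliffordAction D.volume (D.gamma i ψ) = -D.gamma i (D.cliffordAction D.volume ψ) := by
  simp only [gamma, ← Module.End.mul_apply, ← map_mul]
  rw [D.vec_mul_volume hn, map_neg, LinearMap.neg_apply, neg_neg]

theorem gamma_mem_Sc (D : PoincareData n U S 𝔤 V B) (hn : Even n) (i : Fin n) {s : ℤˣ} {ψ : S}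
    (h : ψ ∈ D.Sc s) : D.gamma i ψ ∈ D.Sc (-s) := by
  rw [mem_Sc_iff] at h ⊢
  rw [D.volume_gamma hn, h, map_smul]
  simp

theorem exists_chiral_add (D : PoincareData n U S 𝔤 V B) (hn : Even n) (s : ℤˣ) (ψ : S) :
    ∃ ψ₁ ∈ D.Sc s, ∃ ψ₂ ∈ D.Sc (-s), ψ = ψ₁ + ψ₂ := by
  have hs : ((s : ℤ) : ℂ) * ((s : ℤ) : ℂ) = 1 := by
    rcases Int.units_eq_one_or s with rfl | rfl <;> simp
  -- The images of `ψ` under the projections `½(1 ± sϖ)`.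
  refine ⟨(1 / 2 : ℂ) • (ψ + ((s : ℤ) : ℂ) • D.cliffordAction D.volume ψ), ?_,
    (1 / 2 : ℂ) • (ψ - ((s : ℤ) : ℂ) • D.cliffordAction D.volume ψ), ?_, ?_⟩
  · rw [mem_Sc_iff, map_smul, map_add, map_smul, D.volume_volume hn]
    linear_combination (norm := module) -(1 / 2 : ℂ) • hs • D.cliffordAction D.volume ψ
  · rw [mem_Sc_iff, map_smul, map_sub, map_smul, D.volume_volume hn, Units.val_neg, Int.cast_neg]
    linear_combination (norm := module) -(1 / 2 : ℂ) • hs • D.cliffordAction D.volume ψ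
  · module

theorem eq_zero_of_mem_Sc_of_mem_Sc_neg (D : PoincareData n U S 𝔤 V B) {s : ℤˣ} {ψ : S}
    (h : ψ ∈ D.Sc s) (h' : ψ ∈ D.Sc (-s)) : ψ = 0 := by
  rw [mem_Sc_iff] at h h'
  rw [h, Units.val_neg, Int.cast_neg] at h'
  refine (smul_eq_zero.mp (?_ : (2 : ℂ) • ψ = 0)).resolve_left two_ne_zero
  rcases Int.units_eq_one_or s with rfl | rfl
  · simp only [Units.val_one, Int.cast_one] at h'
    linear_combination (norm := module) h'
  · simp only [Units.val_neg, Units.val_one, Int.cast_neg, Int.cast_one] at h'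
    linear_combination (norm := module) -h'

/-- A gamma matrix is invertible and exchanges the two chiralities, so neither can be missing. -/
theorem exists_mem_Sc_ne_zero (D : PoincareData n U S 𝔤 V B) (hn : Even n) (h : 0 < n)
    (s : ℤˣ) : ∃ ψ ∈ D.Sc s, ψ ≠ 0 := by
  have := D.nontrivial_spinors
  obtain ⟨ψ, hψ⟩ := exists_ne (0 : S)
  obtain ⟨ψ₁, h₁, ψ₂, h₂, rfl⟩ := D.exists_chiral_add hn s ψ
  by_cases h0 : ψ₁ = 0
  · refine ⟨D.gamma ⟨0, h⟩ ψ₂, by simpa using D.gamma_mem_Sc hn ⟨0, h⟩ h₂, ?_⟩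
    rw [Ne, gamma_eq_zero_iff]
    rintro rfl
    exact hψ (by rw [h0, add_zero])
  · exact ⟨ψ₁, h₁, h0⟩

/-- If `p` is odd, then spinors of the same chirality are orthogonal. -/
theorem form_eq_zero_of_odd (D : PoincareData n U S 𝔤 V B) (hn : Even n) (hp : Odd (n / 2))
    {s : ℤˣ} {ψ χ : S} (hψ : ψ ∈ D.Sc s) (hχ : χ ∈ D.Sc s) : D.form ψ χ = 0 := by
  have h := D.form_volume hn ψ χ
  rw [(D.mem_Sc_iff s ψ).mp hψ, (D.mem_Sc_iff s χ).mp hχ, hp.neg_one_pow] at h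
  rcases Int.units_eq_one_or s with rfl | rfl
  · simpa [self_eq_neg] using h
  · simpa [neg_eq_self] using h

/-- If `p` is even, then spinors of opposite chirality are orthogonal. -/
theorem form_eq_zero_of_even (D : PoincareData n U S 𝔤 V B) (hn : Even n) (hp : Even (n / 2))
    {s : ℤˣ} {ψ χ : S} (hψ : ψ ∈ D.Sc s) (hχ : χ ∈ D.Sc (-s)) : D.form ψ χ = 0 := by
  have h := D.form_volume hn ψ χ
  rw [(D.mem_Sc_iff s ψ).mp hψ, (D.mem_Sc_iff (-s) χ).mp hχ, hp.neg_one_pow] at h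
  rcases Int.units_eq_one_or s with rfl | rfl
  · simpa [self_eq_neg] using h
  · simpa [neg_eq_self] using h

/-- If `p` is odd, then a nonzero chiral spinor pairs nontrivially with some spinor of the opposite
chirality. -/
theorem exists_form_ne_zero_of_odd (D : PoincareData n U S 𝔤 V B) (hn : Even n)
    (hp : Odd (n / 2)) {s : ℤˣ} {ψ : S} (hψ : ψ ∈ D.Sc s) (h0 : ψ ≠ 0) :
    ∃ χ ∈ D.Sc (-s), D.form ψ χ ≠ 0 := by
  obtain ⟨χ, hχ⟩ := D.exists_form_ne_zero h0
  obtain ⟨χ₁, h₁, χ₂, h₂, rfl⟩ := D.exists_chiral_add hn s χ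
  rw [map_add, D.form_eq_zero_of_odd hn hp hψ h₁, zero_add] at hχ
  exact ⟨χ₂, h₂, hχ⟩

/-- If `p` is even, then a nonzero chiral spinor pairs nontrivially with some spinor of the same
chirality. -/
theorem exists_form_ne_zero_of_even (D : PoincareData n U S 𝔤 V B) (hn : Even n)
    (hp : Even (n / 2)) {s : ℤˣ} {ψ : S} (hψ : ψ ∈ D.Sc s) (h0 : ψ ≠ 0) :
    ∃ χ ∈ D.Sc s, D.form ψ χ ≠ 0 := by
  obtain ⟨χ, hχ⟩ := D.exists_form_ne_zero h0
  obtain ⟨χ₁, h₁, χ₂, h₂, rfl⟩ := D.exists_chiral_add hn s χ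
  rw [map_add, D.form_eq_zero_of_even hn hp hψ h₂, add_zero] at hχ
  exact ⟨χ₁, h₁, hχ⟩

/-! ### The Jacobi identity on spinors -/

/-- The spinor `ψ` and the vector `v` define an element `ψ ⊗ v` of the odd part: if `n` is even,
they have the same chirality. -/
def Compatible (D : PoincareData n U S 𝔤 V B) (ψ : S) (v : V) : Prop :=
  Even n → ∃ s, ψ ∈ D.Sc s ∧ v ∈ D.Vc s

/-- Puts both parities of `n` on the same footing, so that multilinear identities need testing only
on compatible pure tensors. -/
theorem oddPart_eq_span (D : PoincareData n U S 𝔤 V B) :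
    D.oddPart = Submodule.span ℂ {z | ∃ ψ v, D.Compatible ψ v ∧ z = ψ ⊗ₜ[ℂ] v} := by
  apply le_antisymm
  · unfold oddPart
    split_ifs with hn
    · have key : ∀ s, Submodule.map₂ (TensorProduct.mk ℂ S V) (D.Sc s) (D.Vc s).toSubmodule ≤
          Submodule.span ℂ {z | ∃ ψ v, D.Compatible ψ v ∧ z = ψ ⊗ₜ[ℂ] v} := fun s =>
        Submodule.map₂_le.mpr fun ψ hψ v hv =>
          Submodule.subset_span ⟨ψ, v, fun _ => ⟨s, hψ, hv⟩, rfl⟩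
      exact sup_le (key 1) (key (-1))
    · rw [← TensorProduct.span_tmul_eq_top]
      refine Submodule.span_mono ?_
      rintro _ ⟨ψ, v, rfl⟩
      exact ⟨ψ, v, fun h => absurd h hn, rfl⟩
  · rw [Submodule.span_le]
    rintro _ ⟨ψ, v, h, rfl⟩
    unfold oddPart
    split_ifs with hn
    · obtain ⟨s, hψ, hv⟩ := h hn
      have := Submodule.apply_mem_map₂ (TensorProduct.mk ℂ S V) hψ hv
      rcases Int.units_eq_one_or s with rfl | rfl
      · exact Submodule.mem_sup_left this
      · exact Submodule.mem_sup_right this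
    · exact Submodule.mem_top

theorem evenAction_add (D : PoincareData n U S 𝔤 V B) (a a' : D.EvenPart) :
    D.evenAction (a + a') = D.evenAction a + D.evenAction a' := by
  simp only [evenAction, Prod.fst_add, Prod.snd_add, map_add, LinearMap.rTensor_add,
    LinearMap.lTensor_add]
  abel

theorem evenAction_smul (D : PoincareData n U S 𝔤 V B) (r : ℂ) (a : D.EvenPart) :
    D.evenAction (r • a) = r • D.evenAction a := by
  simp only [evenAction, Prod.smul_fst, Prod.smul_snd, map_smul, LinearMap.rTensor_smul,
    LinearMap.lTensor_smul, smul_add]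

theorem evenAction_zero (D : PoincareData n U S 𝔤 V B) : D.evenAction 0 = 0 := by
  simpa using D.evenAction_smul 0 0

theorem evenBracket_zero (D : PoincareData n U S 𝔤 V B) : D.evenBracket 0 0 = 0 := by
  simp [evenBracket, Prod.ext_iff]

/-- The cyclic sum `[[x, y], z] + [[y, z], x] + [[z, x], y]` for odd `x`, `y` and `z`. -/
noncomputable def jacobiator (D : PoincareData n U S 𝔤 V B) (x y z : S ⊗[ℂ] V) : S ⊗[ℂ] V :=
  D.evenAction (D.oddBracket x y) z + D.evenAction (D.oddBracket y z) x +
    D.evenAction (D.oddBracket z x) y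

/-- Thanks to this symmetry, linearity in the last argument is enough to extend identities in all
three. -/
theorem jacobiator_cycle (D : PoincareData n U S 𝔤 V B) (x y z : S ⊗[ℂ] V) :
    D.jacobiator y z x = D.jacobiator x y z := by
  unfold jacobiator
  abel

theorem jacobiator_add (D : PoincareData n U S 𝔤 V B) (x y z z' : S ⊗[ℂ] V) :
    D.jacobiator x y (z + z') = D.jacobiator x y z + D.jacobiator x y z' := by
  simp only [jacobiator, map_add, LinearMap.add_apply, evenAction_add]
  abel

theorem jacobiator_smul (D : PoincareData n U S 𝔤 V B) (r : ℂ) (x y z : S ⊗[ℂ] V) :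
    D.jacobiator x y (r • z) = r • D.jacobiator x y z := by
  simp only [jacobiator, map_smul, LinearMap.smul_apply, evenAction_smul, smul_add]

theorem jacobiator_tmul (D : PoincareData n U S 𝔤 V B) (ψ χ φ : S) (v w u : V) :
    D.jacobiator (ψ ⊗ₜ v) (χ ⊗ₜ w) (φ ⊗ₜ u) =
      D.form ψ χ • φ ⊗ₜ[ℂ] ⁅D.c v w, u⁆ + D.form χ φ • ψ ⊗ₜ[ℂ] ⁅D.c w u, v⁆ +
        D.form φ ψ • χ ⊗ₜ[ℂ] ⁅D.c u v, w⁆ := by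
  simp only [jacobiator, oddBracket_tmul, evenAction_tmul, map_zero, zero_smul,
    TensorProduct.zero_tmul, zero_add, smul_lie, TensorProduct.tmul_smul]

theorem jacobi111_iff_jacobiator (D : PoincareData n U S 𝔤 V B) :
    D.Jacobi111 ↔ ∀ x ∈ D.oddPart, ∀ y ∈ D.oddPart, ∀ z ∈ D.oddPart, D.jacobiator x y z = 0 := by
  have key : ∀ x y z : D.oddPart,
      D.bracket (D.bracket (0, x) (0, y)) (0, z) + D.bracket (D.bracket (0, y) (0, z)) (0, x) +
        D.bracket (D.bracket (0, z) (0, x)) (0, y) =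
      (0, ⟨D.jacobiator x y z,
        add_mem (add_mem (D.evenAction_mem _ z.2) (D.evenAction_mem _ x.2))
          (D.evenAction_mem _ y.2)⟩) := by
    intro x y z
    refine Prod.ext ?_ (Subtype.ext ?_)
    · simp [bracket, evenBracket, evenAction_zero]
    · simp [bracket, evenBracket_zero, evenAction_zero, jacobiator]
  constructor
  · intro h x hx y hy z hz
    have := h (0, ⟨x, hx⟩) (0, ⟨y, hy⟩) (0, ⟨z, hz⟩) rfl rfl rfl
    rw [key] at this
    exact congrArg (fun a => (a.2 : S ⊗[ℂ] V)) this
  · rintro h ⟨_, x⟩ ⟨_, y⟩ ⟨_, z⟩ rfl rfl rfl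
    rw [key]
    exact Prod.ext rfl (Subtype.ext (h x x.2 y y.2 z z.2))

theorem jacobi111_iff (D : PoincareData n U S 𝔤 V B) :
    D.Jacobi111 ↔ ∀ ψ χ φ : S, ∀ v w u : V, D.Compatible ψ v → D.Compatible χ w →
      D.Compatible φ u → D.form ψ χ • φ ⊗ₜ[ℂ] ⁅D.c v w, u⁆ + D.form χ φ • ψ ⊗ₜ[ℂ] ⁅D.c w u, v⁆ +
        D.form φ ψ • χ ⊗ₜ[ℂ] ⁅D.c u v, w⁆ = 0 := by
  rw [jacobi111_iff_jacobiator, oddPart_eq_span]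
  set G : Set (S ⊗[ℂ] V) := {z | ∃ ψ v, D.Compatible ψ v ∧ z = ψ ⊗ₜ[ℂ] v} with hG
  constructor
  · intro h ψ χ φ v w u hv hw hu
    rw [← jacobiator_tmul]
    exact h _ (Submodule.subset_span ⟨ψ, v, hv, rfl⟩) _ (Submodule.subset_span ⟨χ, w, hw, rfl⟩) _
      (Submodule.subset_span ⟨φ, u, hu, rfl⟩)
  · intro h
    have extend : ∀ x y : S ⊗[ℂ] V, (∀ z ∈ G, D.jacobiator x y z = 0) →
        ∀ z ∈ Submodule.span ℂ G, D.jacobiator x y z = 0 := by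
      intro x y hxy z hz
      induction hz using Submodule.span_induction with
      | mem z hz => exact hxy z hz
      | zero => simpa using D.jacobiator_smul 0 x y 0
      | add z z' _ _ hz hz' => rw [jacobiator_add, hz, hz', add_zero]
      | smul r z _ hz => rw [jacobiator_smul, hz, smul_zero]
    intro x hx y hy
    refine extend x y fun z hz => ?_
    rw [← jacobiator_cycle, ← jacobiator_cycle]
    refine extend z x (fun y hy => ?_) y hy
    rw [← jacobiator_cycle, ← jacobiator_cycle]
    refine extend y z (fun x hx => ?_) x hx
    obtain ⟨φ, u, hu, rfl⟩ := hz
    obtain ⟨χ, w, hw, rfl⟩ := hy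
    obtain ⟨ψ, v, hv, rfl⟩ := hx
    rw [jacobiator_cycle, jacobiator_tmul]
    exact h ψ χ φ v w u hv hw hu

/-- The Jacobi identity, with a linear functional applied to the spinors. -/
theorem Jacobi111.apply_functional {D : PoincareData n U S 𝔤 V B} (h : D.Jacobi111)
    (f : S →ₗ[ℂ] ℂ) {ψ χ φ : S} {v w u : V} (hv : D.Compatible ψ v) (hw : D.Compatible χ w)
    (hu : D.Compatible φ u) :
    (D.form ψ χ * f φ) • ⁅D.c v w, u⁆ + (D.form χ φ * f ψ) • ⁅D.c w u, v⁆ +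
      (D.form φ ψ * f χ) • ⁅D.c u v, w⁆ = 0 := by
  have := congrArg ((TensorProduct.lid ℂ V).toLinearMap ∘ₗ f.rTensor V)
    (D.jacobi111_iff.mp h ψ χ φ v w u hv hw hu)
  simpa [mul_smul] using this

theorem lie_c_swap (D : PoincareData n U S 𝔤 V B) (v w u : V) :
    ⁅D.c v w, u⁆ = D.σ • ⁅D.c w v, u⁆ := by
  rw [D.c_symm, smul_lie]

theorem jacobi111_of_lie_eq_zero (D : PoincareData n U S 𝔤 V B)
    (h : ∀ v w u : V, ⁅D.c v w, u⁆ = 0) : D.Jacobi111 := by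
  rw [jacobi111_iff]
  intros
  simp [h]

/-! ### Small spinor modules -/

/-- As `γ_j² = 1` the plane is stable under `γ_j`, and `γ_i γ_j ψ = -γ_j γ_i ψ` reduces stability
under the other gamma matrices to their values at `ψ`. Irreducibility does the rest. -/
theorem span_pair_eq_top (D : PoincareData n U S 𝔤 V B) (j : Fin n) {ψ : S} (h0 : ψ ≠ 0)
    (h : ∀ i, D.gamma i ψ ∈ Submodule.span ℂ {ψ, D.gamma j ψ}) :
    Submodule.span ℂ {ψ, D.gamma j ψ} = ⊤ := by
  have hj : ∀ χ ∈ Submodule.span ℂ {ψ, D.gamma j ψ},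
      D.gamma j χ ∈ Submodule.span ℂ {ψ, D.gamma j ψ} := by
    intro χ hχ
    obtain ⟨a, b, rfl⟩ := Submodule.mem_span_pair.mp hχ
    exact Submodule.mem_span_pair.mpr ⟨b, a, by
      rw [map_add, map_smul, map_smul, gamma_gamma, add_comm]⟩
  refine D.eq_top_of_gamma_mem _ (fun i χ hχ => ?_)
    (Submodule.subset_span (Set.mem_insert ψ _)) h0
  by_cases hij : i = j
  · exact hij ▸ hj χ hχ
  · obtain ⟨a, b, rfl⟩ := Submodule.mem_span_pair.mp hχ
    rw [map_add, map_smul, map_smul, D.gamma_anticomm hij]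
    exact add_mem (Submodule.smul_mem _ _ (h i))
      (Submodule.smul_mem _ _ (neg_mem (hj _ (h i))))

/-- An eigenvector of the only gamma matrix spans a stable line, hence `S`; nondegeneracy then
forbids it to be isotropic. -/
theorem exists_span_singleton_eq_top (D : PoincareData 1 U S 𝔤 V B) :
    ∃ ψ, D.form ψ ψ ≠ 0 ∧ ∀ φ, ∃ a : ℂ, a • ψ = φ := by
  have := D.nontrivial_spinors
  obtain ⟨χ, hχ⟩ := exists_ne (0 : S)
  obtain ⟨ψ, -, h0, μ, hμ⟩ := exists_eigenvector_mem (D.gamma 0) ⊤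
    (fun _ _ => Submodule.mem_top) (Submodule.mem_top (x := χ)) hχ
  have htop : Submodule.span ℂ {ψ} = ⊤ := by
    refine D.eq_top_of_gamma_mem _ (fun i φ hφ => ?_) (Submodule.mem_span_singleton_self ψ) h0
    obtain ⟨a, rfl⟩ := Submodule.mem_span_singleton.mp hφ
    rw [Subsingleton.elim i 0, map_smul, hμ]
    exact Submodule.smul_mem _ _ (Submodule.smul_mem _ _ (Submodule.mem_span_singleton_self ψ))
  have hspan : ∀ φ, ∃ a : ℂ, a • ψ = φ := fun φ =>
    Submodule.mem_span_singleton.mp (htop ▸ Submodule.mem_top)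
  refine ⟨ψ, fun h => ?_, hspan⟩
  obtain ⟨φ, hφ⟩ := D.exists_form_ne_zero h0
  obtain ⟨a, rfl⟩ := hspan φ
  exact hφ (by rw [map_smul, h, smul_zero])

/-- In two dimensions, the chiral spinors are one-dimensional. -/
theorem exists_smul_eq_of_mem_Sc (D : PoincareData 2 U S 𝔤 V B) {s : ℤˣ} {ψ φ : S}
    (hψ : ψ ∈ D.Sc s) (h0 : ψ ≠ 0) (hφ : φ ∈ D.Sc s) : ∃ a : ℂ, a • ψ = φ := by
  have hvol : Complex.I • D.gamma 0 (D.gamma 1 ψ) = ((s : ℤ) : ℂ) • ψ := by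
    have := (D.mem_Sc_iff s ψ).mp hψ
    rw [volume_action] at this
    simpa [List.finRange_succ] using this
  -- The eigenvalue equation for `ϖ = i γ₀ γ₁` makes `γ₁ ψ` a multiple of `γ₀ ψ`, so `ψ` and `γ₀ ψ`
  -- span `S`.
  have h1 : D.gamma 1 ψ = (-Complex.I * ((s : ℤ) : ℂ)) • D.gamma 0 ψ := by
    have := congrArg (D.gamma 0) hvol
    rw [map_smul, gamma_gamma, map_smul] at this
    rw [mul_smul, ← this, smul_smul]
    simp
  have htop := D.span_pair_eq_top 0 h0 (by
    intro i
    fin_cases i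
    · exact Submodule.subset_span (by simp)
    · exact h1 ▸ Submodule.smul_mem _ _ (Submodule.subset_span (by simp)))
  obtain ⟨a, b, rfl⟩ := Submodule.mem_span_pair.mp (htop ▸ Submodule.mem_top (x := φ))
  -- The `γ₀ ψ` component of `φ` has both chiralities, so it is zero.
  have hb := (Submodule.add_mem_iff_right _ (Submodule.smul_mem _ a hψ)).mp hφ
  have hb' := Submodule.smul_mem _ b (D.gamma_mem_Sc even_two 0 hψ)
  exact ⟨a, by rw [D.eq_zero_of_mem_Sc_of_mem_Sc_neg hb hb', add_zero]⟩

/-- In three dimensions, the product of the gamma matrices is a scalar. -/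
theorem exists_gamma_prod_eq_smul (D : PoincareData 3 U S 𝔤 V B) :
    ∃ μ : ℂ, μ ≠ 0 ∧ ∀ ψ, D.gamma 0 (D.gamma 1 (D.gamma 2 ψ)) = μ • ψ := by
  have := D.nontrivial_spinors
  have a01 := D.gamma_anticomm (i := 0) (j := 1) (by decide)
  have a02 := D.gamma_anticomm (i := 0) (j := 2) (by decide)
  have a12 := D.gamma_anticomm (i := 1) (j := 2) (by decide)
  obtain ⟨χ, hχ⟩ := exists_ne (0 : S)
  obtain ⟨φ, -, h0, μ, hμ⟩ := exists_eigenvector_mem (D.gamma 0 * D.gamma 1 * D.gamma 2) ⊤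
    (fun _ _ => Submodule.mem_top) (Submodule.mem_top (x := χ)) hχ
  -- Schur's lemma: in odd dimension the product of all gamma matrices commutes with each of them,
  -- so its eigenspace is stable.
  have hcomm : ∀ i ψ, (D.gamma 0 * D.gamma 1 * D.gamma 2) (D.gamma i ψ) =
      D.gamma i ((D.gamma 0 * D.gamma 1 * D.gamma 2) ψ) := by
    intro i ψ
    fin_cases i <;>
      simp [Module.End.mul_apply, a01, a02, a12, gamma_gamma]
  have htop := D.eq_top_of_gamma_mem
    (Module.End.eigenspace (D.gamma 0 * D.gamma 1 * D.gamma 2) μ) (fun i ψ hψ => by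
      rw [Module.End.mem_eigenspace_iff] at hψ ⊢
      rw [hcomm, hψ, map_smul]) (Module.End.mem_eigenspace_iff.mpr hμ) h0
  refine ⟨μ, ?_, fun ψ => Module.End.mem_eigenspace_iff.mp (htop ▸ Submodule.mem_top)⟩
  rintro rfl
  simp only [Module.End.mul_apply, zero_smul, gamma_eq_zero_iff] at hμ
  exact h0 hμ

/-- The scalar `μ = γ₀ γ₁ γ₂` crosses the form freely, while moving the three factors gives `τ³` and
the reversed product `-μ`. Hence `τ³ = -1`. -/
theorem τ_eq_neg_one (D : PoincareData 3 U S 𝔤 V B) : D.τ = -1 := by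
  have := D.nontrivial_spinors
  obtain ⟨μ, hμ, h⟩ := D.exists_gamma_prod_eq_smul
  obtain ⟨ψ, hψ⟩ := exists_ne (0 : S)
  obtain ⟨χ, hχ⟩ := D.exists_form_ne_zero hψ
  have hrev : D.gamma 2 (D.gamma 1 (D.gamma 0 χ)) = -(μ • χ) := by
    rw [← h, D.gamma_anticomm (i := 1) (j := 0) (by decide), map_neg,
      D.gamma_anticomm (i := 2) (j := 0) (by decide), neg_neg,
      D.gamma_anticomm (i := 2) (j := 1) (by decide), map_neg]
  have key : D.form (μ • ψ) χ = D.τ * (D.τ * (D.τ * D.form ψ (-(μ • χ)))) := by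
    rw [← h, ← hrev, form_gamma, form_gamma, form_gamma]
  rcases D.τ_sign with hτ | hτ
  · rw [hτ] at key
    simp only [map_smul, LinearMap.smul_apply, map_neg, smul_eq_mul, one_mul] at key
    have : μ * D.form ψ χ = 0 := by linear_combination key / 2
    exact absurd this (mul_ne_zero hμ hχ)
  · exact hτ

/-- In three dimensions, the spinors are two-dimensional with a symplectic form. -/
theorem exists_symplectic_pair (D : PoincareData 3 U S 𝔤 V B) :
    D.σ = -1 ∧ ∃ ψ χ, D.form ψ χ ≠ 0 ∧ ∀ φ, ∃ a b : ℂ, a • ψ + b • χ = φ := by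
  have := D.nontrivial_spinors
  obtain ⟨μ, hμ, h⟩ := D.exists_gamma_prod_eq_smul
  obtain ⟨χ, hχ⟩ := exists_ne (0 : S)
  obtain ⟨ψ, -, h0, ν, hν⟩ := exists_eigenvector_mem (D.gamma 2) ⊤
    (fun _ _ => Submodule.mem_top) (Submodule.mem_top (x := χ)) hχ
  have hν0 : ν ≠ 0 := by
    rintro rfl
    rw [zero_smul, gamma_eq_zero_iff] at hν
    exact h0 hν
  have h1 : D.gamma 1 ψ = (ν⁻¹ * μ) • D.gamma 0 ψ := by
    have := congrArg (D.gamma 0) (h ψ)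
    rw [gamma_gamma, hν, map_smul, map_smul] at this
    rw [mul_smul, ← this, smul_smul, inv_mul_cancel₀ hν0, one_smul]
  have htop := D.span_pair_eq_top 0 h0 (by
    intro i
    fin_cases i
    · exact Submodule.subset_span (by simp)
    · exact h1 ▸ Submodule.smul_mem _ _ (Submodule.subset_span (by simp))
    · exact hν ▸ Submodule.smul_mem _ _ (Submodule.subset_span (by simp)))
  have hspan : ∀ φ, ∃ a b : ℂ, a • ψ + b • D.gamma 0 ψ = φ := fun φ =>
    Submodule.mem_span_pair.mp (htop ▸ Submodule.mem_top)
  have hisotropic : ¬ (D.form ψ ψ = 0 ∧ D.form ψ (D.gamma 0 ψ) = 0) := by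
    rintro ⟨h₁, h₂⟩
    obtain ⟨φ, hφ⟩ := D.exists_form_ne_zero h0
    obtain ⟨a, b, rfl⟩ := hspan φ
    exact hφ (by rw [map_add, map_smul, map_smul, h₁, h₂, smul_zero, smul_zero, add_zero])
  -- If `σ = 1`, then `τ = -1` gives `⟨ψ, γ_i ψ⟩ = 0` for all `i`. As `γ₂ ψ = ν ψ` with `ν ≠ 0`, `ψ`
  -- would be orthogonal to `ψ` and `γ₀ ψ`, hence to all of `S`.
  have hσ : D.σ = -1 := by
    rcases D.σ_sign with hσ | hσ
    · have hz : ∀ i, D.form ψ (D.gamma i ψ) = 0 := by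
        intro i
        have h₁ := D.form_gamma i ψ ψ
        have h₂ := D.form_symm (D.gamma i ψ) ψ
        rw [D.τ_eq_neg_one] at h₁
        rw [hσ] at h₂
        linear_combination (h₁ - h₂) / 2
      have h₂ := hz 2
      rw [hν, map_smul, smul_eq_mul] at h₂
      exact absurd ⟨(mul_eq_zero.mp h₂).resolve_left hν0, hz 0⟩ hisotropic
    · exact hσ
  refine ⟨hσ, ψ, D.gamma 0 ψ, fun h₂ => hisotropic ⟨?_, h₂⟩, hspan⟩
  have := D.form_symm ψ ψ
  rw [hσ] at this
  linear_combination this / 2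

/-! ### Large spinor modules -/

/-- In at least four dimensions, the spinors are at least three-dimensional. -/
theorem exists_notMem_span_pair (D : PoincareData n U S 𝔤 V B) (hn : 4 ≤ n) (ψ χ : S) :
    ∃ φ, φ ∉ Submodule.span ℂ {ψ, χ} := by
  have := D.nontrivial_spinors
  let i₀ : Fin n := ⟨0, by omega⟩
  let i₁ : Fin n := ⟨1, by omega⟩
  let i₂ : Fin n := ⟨2, by omega⟩
  let i₃ : Fin n := ⟨3, by omega⟩
  have a01 := D.gamma_anticomm (i := i₀) (j := i₁) (by simp [i₀, i₁])
  have a02 := D.gamma_anticomm (i := i₀) (j := i₂) (by simp [i₀, i₂])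
  have a03 := D.gamma_anticomm (i := i₀) (j := i₃) (by simp [i₀, i₃])
  have a12 := D.gamma_anticomm (i := i₁) (j := i₂) (by simp [i₁, i₂])
  have a13 := D.gamma_anticomm (i := i₁) (j := i₃) (by simp [i₁, i₃])
  have a23 := D.gamma_anticomm (i := i₂) (j := i₃) (by simp [i₂, i₃])
  obtain ⟨φ₀, hφ₀⟩ := exists_ne (0 : S)
  obtain ⟨φ₁, -, h₁, κ, hκ₁⟩ := exists_eigenvector_mem (D.gamma i₀ * D.gamma i₁) ⊤
    (fun _ _ => Submodule.mem_top) (Submodule.mem_top (x := φ₀)) hφ₀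
  -- `γ₀ γ₁` and `γ₂ γ₃` commute, so they have a common eigenvector.
  obtain ⟨φ, hφ, h0, l, hl⟩ := exists_eigenvector_mem (D.gamma i₂ * D.gamma i₃)
    (Module.End.eigenspace (D.gamma i₀ * D.gamma i₁) κ) (fun θ hθ => by
      rw [Module.End.mem_eigenspace_iff] at hθ ⊢
      rw [← map_smul, ← hθ]
      simp [Module.End.mul_apply, a02, a03, a12, a13])
    (Module.End.mem_eigenspace_iff.mpr hκ₁) h₁
  have hκ := Module.End.mem_eigenspace_iff.mp hφ
  rw [Module.End.mul_apply] at hκ hl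
  have hκ0 : κ ≠ 0 := by
    rintro rfl
    simp only [zero_smul, gamma_eq_zero_iff] at hκ
    exact h0 hκ
  have hl0 : l ≠ 0 := by
    rintro rfl
    simp only [zero_smul, gamma_eq_zero_iff] at hl
    exact h0 hl
  -- The pairs of eigenvalues of `γ₀ γ₁` and `γ₂ γ₃` on these spinors are `(κ, l)`, `(-κ, l)` and
  -- `(κ, -l)`, which are distinct.
  have hind : LinearIndependent ℂ ![φ, D.gamma i₀ φ, D.gamma i₂ φ] := by
    rw [Fintype.linearIndependent_iff]
    intro g hg
    simp only [Fin.sum_univ_three, Matrix.cons_val_zero, Matrix.cons_val_one,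
      Matrix.cons_val] at hg
    have hg₁ := congrArg (fun θ => D.gamma i₀ (D.gamma i₁ θ)) hg
    have hg₂ := congrArg (fun θ => D.gamma i₂ (D.gamma i₃ θ)) hg
    have e₁ : D.gamma i₀ (D.gamma i₁ (D.gamma i₀ φ)) = -(κ • D.gamma i₀ φ) := by
      rw [← map_smul, ← hκ, a01 φ, map_neg, neg_neg]
    have e₂ : D.gamma i₀ (D.gamma i₁ (D.gamma i₂ φ)) = κ • D.gamma i₂ φ := by
      rw [← map_smul, ← hκ, a12, map_neg, a02, neg_neg]
    have e₃ : D.gamma i₂ (D.gamma i₃ (D.gamma i₀ φ)) = l • D.gamma i₀ φ := by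
      rw [← map_smul, ← hl, a02, a03, map_neg, neg_neg]
    have e₄ : D.gamma i₂ (D.gamma i₃ (D.gamma i₂ φ)) = -(l • D.gamma i₂ φ) := by
      rw [← map_smul, ← hl, a23 φ, map_neg, neg_neg]
    simp only [map_add, map_smul, map_zero, hκ, hl, e₁, e₂, e₃, e₄] at hg₁ hg₂
    have hb : (2 * (κ * g 1)) • D.gamma i₀ φ = 0 := by
      linear_combination (norm := module) κ • hg - hg₁
    have hc : (2 * (l * g 2)) • D.gamma i₂ φ = 0 := by
      linear_combination (norm := module) l • hg - hg₂
    simp only [smul_eq_zero, mul_eq_zero, hκ0, hl0, two_ne_zero, gamma_eq_zero_iff, h0, false_or,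
      or_false] at hb hc
    simp only [hb, hc, zero_smul, add_zero, smul_eq_zero, h0, or_false] at hg
    intro i
    fin_cases i
    exacts [hg, hb, hc]
  classical
  by_contra! h
  have htop : Submodule.span ℂ (({ψ, χ} : Finset S) : Set S) = ⊤ :=
    eq_top_iff.mpr fun φ _ => by simpa using h φ
  have h2 := (finrank_span_finset_le_card (R := ℂ) ({ψ, χ} : Finset S)).trans Finset.card_le_two
  rw [Set.finrank, htop, finrank_top] at h2
  have h3 := hind.fintype_card_le_finrank
  rw [Fintype.card_fin] at h3
  omega

/-- In at least three dimensions, chiral spinors are at least two-dimensional. -/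
theorem exists_notMem_span_singleton (D : PoincareData n U S 𝔤 V B) (hn : Even n) (h3 : 3 ≤ n)
    (s : ℤˣ) : ∃ ψ ∈ D.Sc s, ψ ≠ 0 ∧ ∃ φ ∈ D.Sc s, φ ∉ Submodule.span ℂ {ψ} := by
  let i₀ : Fin n := ⟨0, by omega⟩
  let i₁ : Fin n := ⟨1, by omega⟩
  let i₂ : Fin n := ⟨2, by omega⟩
  have a01 := D.gamma_anticomm (i := i₀) (j := i₁) (by simp [i₀, i₁])
  have a02 := D.gamma_anticomm (i := i₀) (j := i₂) (by simp [i₀, i₂])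
  have a12 := D.gamma_anticomm (i := i₁) (j := i₂) (by simp [i₁, i₂])
  have hmem : ∀ i j, ∀ ψ ∈ D.Sc s, D.gamma i (D.gamma j ψ) ∈ D.Sc s := fun i j ψ hψ => by
    simpa using D.gamma_mem_Sc hn i (D.gamma_mem_Sc hn j hψ)
  obtain ⟨ψ₀, hψ₀, h₀⟩ := D.exists_mem_Sc_ne_zero hn (by omega) s
  obtain ⟨ψ, hψ, h0, κ, hκ⟩ := exists_eigenvector_mem (D.gamma i₀ * D.gamma i₁) (D.Sc s)
    (hmem i₀ i₁) hψ₀ h₀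
  rw [Module.End.mul_apply] at hκ
  -- `γ₀ γ₂` preserves chirality and anticommutes with `γ₀ γ₁`, so it sends `ψ` to an eigenvector
  -- with eigenvalue `-κ ≠ κ`.
  refine ⟨ψ, hψ, h0, D.gamma i₀ (D.gamma i₂ ψ), hmem i₀ i₂ ψ hψ, fun h => ?_⟩
  obtain ⟨a, ha⟩ := Submodule.mem_span_singleton.mp h
  have hanti : D.gamma i₀ (D.gamma i₁ (D.gamma i₀ (D.gamma i₂ ψ))) =
      -D.gamma i₀ (D.gamma i₂ (D.gamma i₀ (D.gamma i₁ ψ))) := by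
    simp [a01, a02, a12, gamma_gamma]
  rw [hκ, ← ha, map_smul, map_smul, map_smul, map_smul, hκ, ← ha, smul_smul, smul_smul,
    ← neg_smul] at hanti
  have hκ0 : κ ≠ 0 := by
    rintro rfl
    simp only [zero_smul, gamma_eq_zero_iff] at hκ
    exact h0 hκ
  have ha0 : a ≠ 0 := by
    rintro rfl
    rw [zero_smul, eq_comm, gamma_eq_zero_iff, gamma_eq_zero_iff] at ha
    exact h0 ha
  have := smul_left_injective ℂ h0 hanti
  exact mul_ne_zero hκ0 ha0 (by linear_combination this / 2)

/-! ### The Jacobi identity in each dimension -/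

theorem compatible_of_odd (D : PoincareData n U S 𝔤 V B) (hn : ¬ Even n) (ψ : S) (v : V) :
    D.Compatible ψ v := fun h => absurd h hn

theorem compatible_of_mem (D : PoincareData n U S 𝔤 V B) {s : ℤˣ} {ψ : S} {v : V}
    (hψ : ψ ∈ D.Sc s) (hv : v ∈ D.Vc s) : D.Compatible ψ v := fun _ => ⟨s, hψ, hv⟩

theorem σ_mul_self (D : PoincareData n U S 𝔤 V B) : D.σ * D.σ = 1 := by
  rcases D.σ_sign with h | h <;> simp [h]

theorem exists_chiral_add_vector (D : PoincareData n U S 𝔤 V B) (hn : Even n) (s : ℤˣ) (v : V) :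
    ∃ v₁ ∈ D.Vc s, ∃ v₂ ∈ D.Vc (-s), v = v₁ + v₂ := by
  have h : v ∈ D.Vc 1 ⊔ D.Vc (-1) := (D.Vc_compl hn).sup_eq_top ▸ LieSubmodule.mem_top v
  obtain ⟨v₁, h₁, v₂, h₂, rfl⟩ := (LieSubmodule.mem_sup _ _ _).mp h
  rcases Int.units_eq_one_or s with rfl | rfl
  · exact ⟨v₁, h₁, v₂, h₂, rfl⟩
  · exact ⟨v₂, h₂, v₁, by rwa [neg_neg], add_comm _ _⟩

theorem jacobi111_iff_one (D : PoincareData 1 U S 𝔤 V B) :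
    D.Jacobi111 ↔ ∀ v w u : V, ⁅D.c v w, u⁆ + ⁅D.c w u, v⁆ + ⁅D.c u v, w⁆ = 0 := by
  have hodd := D.compatible_of_odd (by decide)
  obtain ⟨ψ, hψ, hspan⟩ := D.exists_span_singleton_eq_top
  constructor
  · intro h v w u
    have := h.apply_functional (D.form ψ) (hodd ψ v) (hodd ψ w) (hodd ψ u)
    rw [← smul_add, ← smul_add] at this
    exact (smul_eq_zero.mp this).resolve_left (mul_ne_zero hψ hψ)
  · intro h
    rw [jacobi111_iff]
    intro ψ₁ ψ₂ ψ₃ v w u _ _ _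
    obtain ⟨a, rfl⟩ := hspan ψ₁
    obtain ⟨b, rfl⟩ := hspan ψ₂
    obtain ⟨c, rfl⟩ := hspan ψ₃
    have := congrArg (fun x => (a * b * c * D.form ψ ψ) • ψ ⊗ₜ[ℂ] x) (h v w u)
    simp only [TensorProduct.tmul_add, TensorProduct.tmul_zero, smul_zero] at this
    simp only [map_smul, LinearMap.smul_apply, smul_eq_mul, TensorProduct.smul_tmul']
    simp only [← TensorProduct.smul_tmul']
    linear_combination (norm := module) this

/-- Up to rotation this is the only mixed configuration: the middle entry has the odd chirality out.
Then `c(u, v) = 0`, while `φ` is a multiple of `ψ`, so the other two terms combine into the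
hypothesis. -/
theorem cyclic_sum_eq_zero_of_two (D : PoincareData 2 U S 𝔤 V B)
    (h : ∀ s : ℤˣ, ∀ v ∈ D.Vc s, ∀ w ∈ D.Vc (-s), ∀ u ∈ D.Vc s,
      ⁅D.c v w, u⁆ + ⁅D.c u w, v⁆ = 0) {s : ℤˣ} {ψ χ φ : S} {v w u : V}
    (hψ : ψ ∈ D.Sc s) (hφ : φ ∈ D.Sc s)
    (hv : v ∈ D.Vc s) (hw : w ∈ D.Vc (-s)) (hu : u ∈ D.Vc s) :
    D.form ψ χ • φ ⊗ₜ[ℂ] ⁅D.c v w, u⁆ + D.form χ φ • ψ ⊗ₜ[ℂ] ⁅D.c w u, v⁆ +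
      D.form φ ψ • χ ⊗ₜ[ℂ] ⁅D.c u v, w⁆ = 0 := by
  rw [D.c_chiral_of_odd (by decide) (by decide) s u hu v hv, zero_lie, TensorProduct.tmul_zero,
    smul_zero, add_zero]
  by_cases h0 : ψ = 0
  · simp [h0]
  obtain ⟨a, rfl⟩ := D.exists_smul_eq_of_mem_Sc hψ h0 hφ
  rw [D.lie_c_swap w u v, D.form_symm χ, eq_neg_of_add_eq_zero_left (h s v hv w hw u hu)]
  simp only [map_smul, LinearMap.smul_apply, smul_eq_mul, TensorProduct.tmul_smul,
    TensorProduct.tmul_neg, ← TensorProduct.smul_tmul']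
  linear_combination (norm := module)
    (D.form ψ χ * a) • D.σ_mul_self • (ψ ⊗ₜ[ℂ] ⁅D.c u w, v⁆)

theorem jacobi111_iff_two (D : PoincareData 2 U S 𝔤 V B) :
    D.Jacobi111 ↔ ∀ s : ℤˣ, ∀ v ∈ D.Vc s, ∀ w ∈ D.Vc (-s), ∀ u ∈ D.Vc s,
      ⁅D.c v w, u⁆ + ⁅D.c u w, v⁆ = 0 := by
  constructor
  · intro h s v hv w hw u hu
    obtain ⟨ψ, hψ, h0⟩ := D.exists_mem_Sc_ne_zero even_two two_pos s
    obtain ⟨χ, hχ, hform⟩ := D.exists_form_ne_zero_of_odd even_two (by decide) hψ h0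
    have := h.apply_functional (LinearMap.flip D.form χ) (D.compatible_of_mem hψ hv)
      (D.compatible_of_mem hχ hw) (D.compatible_of_mem hψ hu)
    rw [LinearMap.flip_apply, D.c_chiral_of_odd even_two (by decide) s u hu v hv, zero_lie,
      smul_zero, add_zero, D.form_symm χ ψ, D.lie_c_swap w u v, smul_smul] at this
    -- Swapping the form and swapping `c` each give a factor `σ`, and these cancel.
    have e : D.σ * D.form ψ χ * D.form ψ χ * D.σ = D.form ψ χ * D.form ψ χ := by
      linear_combination (D.form ψ χ * D.form ψ χ) * D.σ_mul_self
    rw [e, ← smul_add] at this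
    exact (smul_eq_zero.mp this).resolve_left (mul_ne_zero hform hform)
  · intro h
    rw [jacobi111_iff]
    intro ψ χ φ v w u hψ hχ hφ
    obtain ⟨s, hψ, hv⟩ := hψ even_two
    obtain ⟨t, hχ, hw⟩ := hχ even_two
    obtain ⟨r, hφ, hu⟩ := hφ even_two
    by_cases hst : t = s
    · subst hst
      by_cases hrt : r = t
      · subst hrt
        have hc := D.c_chiral_of_odd even_two (by decide) r
        simp [hc v hv w hw, hc w hw u hu, hc u hu v hv]
      · obtain rfl := Int.units_ne_iff_eq_neg.mp hrt
        have := D.cyclic_sum_eq_zero_of_two h (χ := φ) hχ hψ hw hu hv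
        rw [← this]
        abel
    · obtain rfl := Int.units_ne_iff_eq_neg.mp hst
      by_cases hrs : r = s
      · subst hrs
        exact D.cyclic_sum_eq_zero_of_two h hψ hφ hv hw hu
      · obtain rfl := Int.units_ne_iff_eq_neg.mp hrs
        have := D.cyclic_sum_eq_zero_of_two h (χ := ψ) hφ hχ hu (by rwa [neg_neg]) hw
        rw [← this]
        abel

/-- Since `c` is antisymmetric, the condition makes `c(v, w)·u` totally antisymmetric, so the three
vectors agree. Their common coefficient, the cyclic sum of `⟨ψ, χ⟩ φ`, is alternating and trilinear
on a plane, hence zero. Conversely, take `φ = ψ`. -/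
theorem jacobi111_iff_three (D : PoincareData 3 U S 𝔤 V B) :
    D.Jacobi111 ↔ ∀ v w u : V, ⁅D.c v w, u⁆ + ⁅D.c u w, v⁆ = 0 := by
  have hodd := D.compatible_of_odd (by decide)
  obtain ⟨hσ, ψ, χ, hform, hspan⟩ := D.exists_symplectic_pair
  have hself : ∀ φ, D.form φ φ = 0 := fun φ => by
    have := D.form_symm φ φ
    rw [hσ] at this
    linear_combination this / 2
  have hswap : ∀ v w u : V, ⁅D.c v w, u⁆ = -⁅D.c w v, u⁆ := fun v w u => by
    rw [D.lie_c_swap, hσ, neg_one_smul]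
  have hχψ : D.form χ ψ = -D.form ψ χ := by rw [D.form_symm, hσ, neg_one_mul]
  constructor
  · intro h v w u
    have := h.apply_functional (LinearMap.flip D.form χ) (hodd ψ v) (hodd χ w) (hodd ψ u)
    rw [LinearMap.flip_apply, hself, zero_mul, zero_smul, add_zero, hχψ, hswap w u v, neg_mul,
      neg_smul_neg, ← smul_add] at this
    exact (smul_eq_zero.mp this).resolve_left (mul_ne_zero hform hform)
  · intro h
    rw [jacobi111_iff]
    intro ψ₁ ψ₂ ψ₃ v w u _ _ _
    have h₁ : ⁅D.c w u, v⁆ = ⁅D.c v w, u⁆ := by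
      rw [hswap w u v, eq_neg_of_add_eq_zero_left (h v w u)]
    have h₂ : ⁅D.c u v, w⁆ = ⁅D.c w u, v⁆ := by
      rw [hswap u v w, eq_neg_of_add_eq_zero_left (h v u w), neg_neg]
    obtain ⟨a₁, b₁, rfl⟩ := hspan ψ₁
    obtain ⟨a₂, b₂, rfl⟩ := hspan ψ₂
    obtain ⟨a₃, b₃, rfl⟩ := hspan ψ₃
    rw [h₂, h₁]
    simp only [map_add, map_smul, LinearMap.add_apply, LinearMap.smul_apply, hself, hχψ,
      smul_eq_mul, TensorProduct.add_tmul, ← TensorProduct.smul_tmul']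
    module

theorem lie_eq_zero_of_chiral (D : PoincareData n U S 𝔤 V B) (hn : Even n)
    (h : ∀ s t r : ℤˣ, ∀ v ∈ D.Vc s, ∀ w ∈ D.Vc t, ∀ u ∈ D.Vc r, ⁅D.c v w, u⁆ = 0) (v w u : V) :
    ⁅D.c v w, u⁆ = 0 := by
  obtain ⟨v₁, hv₁, v₂, hv₂, rfl⟩ := D.exists_chiral_add_vector hn 1 v
  obtain ⟨w₁, hw₁, w₂, hw₂, rfl⟩ := D.exists_chiral_add_vector hn 1 w
  obtain ⟨u₁, hu₁, u₂, hu₂, rfl⟩ := D.exists_chiral_add_vector hn 1 u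
  simp only [map_add, LinearMap.add_apply, add_lie, lie_add, h _ _ _ _ hv₁ _ hw₁ _ hu₁,
    h _ _ _ _ hv₁ _ hw₁ _ hu₂, h _ _ _ _ hv₁ _ hw₂ _ hu₁, h _ _ _ _ hv₁ _ hw₂ _ hu₂,
    h _ _ _ _ hv₂ _ hw₁ _ hu₁, h _ _ _ _ hv₂ _ hw₁ _ hu₂, h _ _ _ _ hv₂ _ hw₂ _ hu₁,
    h _ _ _ _ hv₂ _ hw₂ _ hu₂, add_zero]

/-- A functional that kills `ψ` and `χ` but not a third independent spinor leaves only one term. -/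
theorem Jacobi111.lie_eq_zero_of_odd {D : PoincareData n U S 𝔤 V B} (h : D.Jacobi111)
    (h4 : 4 ≤ n) (hn : ¬ Even n) (v w u : V) : ⁅D.c v w, u⁆ = 0 := by
  have hodd := D.compatible_of_odd hn
  have := D.nontrivial_spinors
  obtain ⟨ψ, h0⟩ := exists_ne (0 : S)
  obtain ⟨χ, hχ⟩ := D.exists_form_ne_zero h0
  obtain ⟨φ, hφ⟩ := D.exists_notMem_span_pair h4 ψ χ
  obtain ⟨f, hf, hle⟩ := Submodule.exists_le_ker_of_notMem hφ
  have hfψ : f ψ = 0 := hle (Submodule.subset_span (by simp))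
  have hfχ : f χ = 0 := hle (Submodule.subset_span (by simp))
  have := h.apply_functional f (hodd ψ v) (hodd χ w) (hodd φ u)
  rw [hfψ, hfχ, mul_zero, mul_zero, zero_smul, zero_smul, add_zero, add_zero] at this
  exact (smul_eq_zero.mp this).resolve_left (mul_ne_zero hχ hf)

/-- With `ψ` and `φ` independent of the same chirality, `⟨φ, ψ⟩ = 0` removes one term and a
functional that vanishes on `ψ` but not on `φ` removes another. -/
theorem Jacobi111.lie_eq_zero_of_even_of_odd_half {D : PoincareData n U S 𝔤 V B}
    (h : D.Jacobi111) (h3 : 3 ≤ n) (hn : Even n) (hp : Odd (n / 2)) (v w u : V) :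
    ⁅D.c v w, u⁆ = 0 := by
  have key : ∀ s, ∀ v ∈ D.Vc s, ∀ w ∈ D.Vc (-s), ∀ u ∈ D.Vc s, ⁅D.c v w, u⁆ = 0 := by
    intro s v hv w hw u hu
    obtain ⟨ψ, hψ, h0, φ, hφ, hnot⟩ := D.exists_notMem_span_singleton hn h3 s
    obtain ⟨χ, hχ, hform⟩ := D.exists_form_ne_zero_of_odd hn hp hψ h0
    obtain ⟨f, hf, hle⟩ := Submodule.exists_le_ker_of_notMem hnot
    have hfψ : f ψ = 0 := hle (Submodule.mem_span_singleton_self ψ)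
    have := h.apply_functional f (D.compatible_of_mem hψ hv) (D.compatible_of_mem hχ hw)
      (D.compatible_of_mem hφ hu)
    rw [hfψ, D.form_eq_zero_of_odd hn hp hφ hψ, mul_zero, zero_mul, zero_smul, zero_smul,
      add_zero, add_zero] at this
    exact (smul_eq_zero.mp this).resolve_left (mul_ne_zero hform hf)
  refine D.lie_eq_zero_of_chiral hn (fun s t r v hv w hw u hu => ?_) v w u
  by_cases hst : t = s
  · subst hst
    rw [D.c_chiral_of_odd hn hp t v hv w hw, zero_lie]
  obtain rfl := Int.units_ne_iff_eq_neg.mp hst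
  by_cases hrs : r = s
  · subst hrs
    exact key r v hv w hw u hu
  obtain rfl := Int.units_ne_iff_eq_neg.mp hrs
  rw [D.lie_c_swap, key (-s) w hw v (by rwa [neg_neg]) u hu, smul_zero]

theorem Jacobi111.lie_eq_zero_of_even_of_even_half {D : PoincareData n U S 𝔤 V B}
    (h : D.Jacobi111) (h0 : 0 < n) (hn : Even n) (hp : Even (n / 2)) (v w u : V) :
    ⁅D.c v w, u⁆ = 0 := by
  have key : ∀ s, ∀ v ∈ D.Vc s, ∀ w ∈ D.Vc s, ∀ u ∈ D.Vc (-s), ⁅D.c v w, u⁆ = 0 := by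
    intro s v hv w hw u hu
    obtain ⟨ψ, hψ, hψ0⟩ := D.exists_mem_Sc_ne_zero hn h0 s
    obtain ⟨χ, hχ, hform⟩ := D.exists_form_ne_zero_of_even hn hp hψ hψ0
    obtain ⟨φ, hφ, hφ0⟩ := D.exists_mem_Sc_ne_zero hn h0 (-s)
    obtain ⟨f, hf, -⟩ := Submodule.exists_le_ker_of_notMem
      (p := (⊥ : Submodule ℂ S)) (fun h => hφ0 ((Submodule.mem_bot ℂ).mp h))
    have := h.apply_functional f (D.compatible_of_mem hψ hv) (D.compatible_of_mem hχ hw)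
      (D.compatible_of_mem hφ hu)
    -- The other two terms contain `c` of vectors of opposite chirality, so any functional with `f φ
    -- ≠ 0` will do.
    rw [D.c_chiral_of_even hn hp s w hw u hu,
      D.c_chiral_of_even hn hp (-s) u hu v (by rwa [neg_neg]), zero_lie, zero_lie, smul_zero,
      smul_zero, add_zero, add_zero] at this
    exact (smul_eq_zero.mp this).resolve_left (mul_ne_zero hform hf)
  refine D.lie_eq_zero_of_chiral hn (fun s t r v hv w hw u hu => ?_) v w u
  by_cases hst : t = s
  · subst hst
    by_cases hrt : r = t
    · subst hrt
      -- `c(v, w)·u` is `b`-orthogonal to its own chirality, and to the opposite one by invariance,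
      -- since `c(v, w)` acts there by zero.
      refine D.b_nondeg.1 _ fun y => ?_
      obtain ⟨y₁, h₁, y₂, h₂, rfl⟩ := D.exists_chiral_add_vector hn r y
      have := D.b_invariant (D.c v w) u y₂
      rw [key r v hv w hw y₂ h₂, map_zero, add_zero] at this
      rw [map_add, this, add_zero,
        D.b_chiral_of_even hn hp r _ (LieSubmodule.lie_mem _ hu) y₁ h₁]
    · obtain rfl := Int.units_ne_iff_eq_neg.mp hrt
      exact key t v hv w hw u hu
  · obtain rfl := Int.units_ne_iff_eq_neg.mp hst
    rw [D.c_chiral_of_even hn hp s v hv w hw, zero_lie]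

theorem jacobi111_iff_of_four_le (D : PoincareData n U S 𝔤 V B) (h4 : 4 ≤ n) :
    D.Jacobi111 ↔ ∀ v w u : V, ⁅D.c v w, u⁆ = 0 := by
  refine ⟨fun h => ?_, D.jacobi111_of_lie_eq_zero⟩
  by_cases hn : Even n
  · rcases Nat.even_or_odd (n / 2) with hp | hp
    · exact h.lie_eq_zero_of_even_of_even_half (by omega) hn hp
    · exact h.lie_eq_zero_of_even_of_odd_half (by omega) hn hp
  · exact h.lie_eq_zero_of_odd h4 hn

end PoincareData

end PoincareSuper

theorem theorem4p4 {n : ℕ} {U S 𝔤 V : Type*}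
    [AddCommGroup U] [Module ℂ U] [FiniteDimensional ℂ U]
    {B : LinearMap.BilinForm ℂ U}
    [AddCommGroup S] [Module ℂ S] [FiniteDimensional ℂ S]
    [Module (CliffordAlgebra (LinearMap.BilinMap.toQuadraticMap B)) S]
    [IsScalarTower ℂ (CliffordAlgebra (LinearMap.BilinMap.toQuadraticMap B)) S]
    [IsSimpleModule (CliffordAlgebra (LinearMap.BilinMap.toQuadraticMap B)) S]
    [LieRing 𝔤] [LieAlgebra ℂ 𝔤] [FiniteDimensional ℂ 𝔤]
    [AddCommGroup V] [Module ℂ V] [FiniteDimensional ℂ V]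
    [LieRingModule 𝔤 V] [LieModule ℂ 𝔤 V]
    (D : PoincareSuper.PoincareData n U S 𝔤 V B) :
    (4 ≤ n → (D.Jacobi111 ↔ ∀ v w u : V, ⁅D.c v w, u⁆ = 0)) ∧
    (n = 3 → (D.Jacobi111 ↔ ∀ v w u : V, ⁅D.c v w, u⁆ + ⁅D.c u w, v⁆ = 0)) ∧
    (n = 2 → (D.Jacobi111 ↔
      ∀ s : ℤˣ, ∀ v ∈ D.Vc s, ∀ w ∈ D.Vc (-s), ∀ u ∈ D.Vc s,
        ⁅D.c v w, u⁆ + ⁅D.c u w, v⁆ = 0)) ∧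
    (n = 1 → (D.Jacobi111 ↔
      ∀ v w u : V, ⁅D.c v w, u⁆ + ⁅D.c w u, v⁆ + ⁅D.c u v, w⁆ = 0)) := by
  refine ⟨D.jacobi111_iff_of_four_le, ?_, ?_, ?_⟩
  · rintro rfl
    exact D.jacobi111_iff_three
  · rintro rfl
    exact D.jacobi111_iff_two
  · rintro rfl
    exact D.jacobi111_iff_one
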